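/- Let $G$ be a finite group. A pair $(H,K)$ of subgroups of $G$ is a Shoda pair if $K\trianglelefteq H$, $H/K$ is cyclic, and every $g\in G$ with $\{h^{-1}g^{-1}hg : h\in H\}\cap H\subseteq K$ lies in $H$. Let $\lambda:H\to\mathbb{C}^{\times}$ be a linear character with kernel $K$. For $H\le L\le G$ let $\lambda^{L}$ be the induced character and $$e_{\mathbb{Q}}(\lambda^{L})=\frac{1}{|H|}\sum_{\sigma\in\operatorname{Gal}(\mathbb{Q}(\lambda^{L})/\mathbb{Q})}\ \sum_{x\in L}\sigma(\lambda^{L}(x))\,x^{-1}\in\mathbb{Q}L .$$ A strong inductive chain from $H$ to $G$ is a chain of subgroups $H=H_0\le H_1\le\cdots\le H_n=G$ such that for all $0\le i\le n-1$: (i) $H_i\trianglelefteq C_i:=\operatorname{Cen}_{H_{i+1}}(e_{\mathbb{Q}}(\lambda^{H_i}))$; (ii) the distinct $H_{i+1}$-conjugates of $e_{\mathbb{Q}}(\lambda^{H_i})$ are mutually orthogonal. A Shoda pair $(H,K)$ for which such a chain exists is called a generalized strong Shoda pair of $G$. Let $(H,K)$ be a generalized strong Shoda pair of $G$, let $\lambda$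 be a linear character of $H$ with kernel $K$, and let $H=H_0\le H_1\le\cdots\le H_n=G$ be any strong inductive chain from $H$ to $G$. Then $(H,K)$ has the least center property with respect to this chain: for every $0\le i\le n-1$, the center of $\mathbb{Q}H_{i+1}e_{\mathbb{Q}}(\lambda^{H_{i+1}})$ is the subring of the center of $\mathbb{Q}H_{i}e_{\mathbb{Q}}(\lambda^{H_{i}})$ fixed by the conjugation action of $C_i/H_i$. Precisely, the map $z\mapsto z\,e_{\mathbb{Q}}(\lambda^{H_i})$ is a ring isomorphism $$\mathcal{Z}\big(\mathbb{Q}H_{i+1}e_{\mathbb{Q}}(\lambda^{H_{i+1}})\big)\ \xrightarrow{\ \sim\ }\ \mathcal{Z}\big(\mathbb{Q}H_{i}e_{\mathbb{Q}}(\lambda^{H_{i}})\big)^{C_i/H_i}.$$ -/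

import Mathlib

noncomputable section

namespace ShodaTheory

variable {G : Type*} [Group G]

/-- `(H, K)` is a Shoda pair of `G`: `K ⊴ H`, `H / K` is cyclic, and every `g ∈ G` with
`[H, g] ∩ H ⊆ K` lies in `H`, where `[H, g]` is the set of commutators `h⁻¹ g⁻¹ h g`, `h ∈ H`. -/
structure IsShodaPair (H K : Subgroup G) : Prop where
  le : K ≤ H
  normal : (K.subgroupOf H).Normal
  isCyclic : haveI := normal; IsCyclic (↥H ⧸ K.subgroupOf H)
  mem_of_commutators : ∀ g : G, (∀ h ∈ H, h⁻¹ * g⁻¹ * h * g ∈ H → h⁻¹ * g⁻¹ * h * g ∈ K) → g ∈ H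

section Idempotent

variable [Fintype G] {H : Subgroup G}

open Classical in
/-- The induced character `χ^L : L → ℂ` of a linear character `χ` of `H ≤ L`:
`χ^L(x) = |H|⁻¹ ∑_{y ∈ L, y⁻¹ x y ∈ H} χ(y⁻¹ x y)`. -/
def indChar (χ : H →* ℂˣ) (L : Subgroup G) (x : L) : ℂ :=
  (Nat.card H : ℂ)⁻¹ * ∑ y : L,
    if hy : (y : G)⁻¹ * (x : G) * (y : G) ∈ H then ((χ ⟨(y : G)⁻¹ * (x : G) * (y : G), hy⟩ : ℂˣ) : ℂ)
    else 0

/-- The character field `ℚ(χ^L)`, as a subfield of `ℂ`. -/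
def charField (χ : H →* ℂˣ) (L : Subgroup G) : IntermediateField ℚ ℂ :=
  IntermediateField.adjoin ℚ (Set.range (indChar χ L))

/-- A value of `χ^L`, as an element of the character field. -/
def charValue (χ : H →* ℂˣ) (L : Subgroup G) (x : L) : charField χ L :=
  ⟨indChar χ L x, IntermediateField.subset_adjoin ℚ _ ⟨x, rfl⟩⟩

open Classical in
/-- The element `e_ℚ(χ^L) = |H|⁻¹ ∑_{σ ∈ Gal(ℚ(χ^L)/ℚ)} ∑_{x ∈ L} σ(χ^L(x)) x⁻¹` of `ℚG`.
As `ℚ(χ^L)` is a finite Galois extension of `ℚ`, the sum over `σ` is the field trace to `ℚ`. -/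
def eQ (χ : H →* ℂˣ) (L : Subgroup G) : MonoidAlgebra ℚ G :=
  (Nat.card H : ℚ)⁻¹ • ∑ x : L,
    MonoidAlgebra.single ((x : G)⁻¹) (Algebra.trace ℚ (charField χ L) (charValue χ L x))

end Idempotent

/-- The group algebra `ℚL`, as a subalgebra of `ℚG`. -/
def groupSubalgebra (L : Subgroup G) : Subalgebra ℚ (MonoidAlgebra ℚ G) :=
  (MonoidAlgebra.mapDomainAlgHom ℚ ℚ L.subtype).range

/-- The conjugate `a^g = g⁻¹ a g`. -/
def conj (a : MonoidAlgebra ℚ G) (g : G) : MonoidAlgebra ℚ G :=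
  MonoidAlgebra.single g⁻¹ 1 * a * MonoidAlgebra.single g 1

theorem single_mul_single_inv (g : G) :
    (MonoidAlgebra.single g 1 * MonoidAlgebra.single g⁻¹ 1 : MonoidAlgebra ℚ G) = 1 := by
  simp [MonoidAlgebra.single_mul_single, MonoidAlgebra.one_def]

theorem conj_mul (a b : MonoidAlgebra ℚ G) (g : G) : conj (a * b) g = conj a g * conj b g := by
  unfold conj
  have h := single_mul_single_inv g
  calc _ = MonoidAlgebra.single g⁻¹ 1 * a * 1 * b * MonoidAlgebra.single g 1 := by
        simp only [mul_one, mul_assoc]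
    _ = _ := by rw [← h]; simp only [mul_assoc]

/-- `Cen_M(a)`: the elements of the subgroup `M` that commute with `a ∈ ℚG`. -/
def cen (M : Subgroup G) (a : MonoidAlgebra ℚ G) : Subgroup G :=
  M ⊓
    { carrier := {g | MonoidAlgebra.single g 1 * a = a * MonoidAlgebra.single g 1}
      one_mem' := by simp [← MonoidAlgebra.one_def]
      mul_mem' := by
        intro x y hx hy
        simp only [Set.mem_ofPred_eq] at *
        have hxy : (MonoidAlgebra.single (x * y) 1 : MonoidAlgebra ℚ G) =
            MonoidAlgebra.single x 1 * MonoidAlgebra.single y 1 := by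
          simp [MonoidAlgebra.single_mul_single]
        rw [hxy, mul_assoc, hy, ← mul_assoc, hx, mul_assoc]
      inv_mem' := by
        intro x hx
        simp only [Set.mem_ofPred_eq] at *
        have h := single_mul_single_inv x
        have h' := single_mul_single_inv x⁻¹
        rw [inv_inv] at h'
        calc _ = MonoidAlgebra.single x⁻¹ 1 *
              (a * MonoidAlgebra.single x 1) * MonoidAlgebra.single x⁻¹ 1 := by
              rw [mul_assoc, mul_assoc, h, mul_one]
          _ = _ := by rw [← hx, ← mul_assoc, h', one_mul] }

section Component

variable [Fintype G] {H : Subgroup G}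

theorem eQ_mem (χ : H →* ℂˣ) (L : Subgroup G) : eQ χ L ∈ groupSubalgebra L := by
  refine Subalgebra.smul_mem _ (Subalgebra.sum_mem _ fun x _ => ?_) _
  exact ⟨MonoidAlgebra.single x⁻¹ (Algebra.trace ℚ (charField χ L) (charValue χ L x)), by simp⟩

theorem indChar_conj (χ : H →* ℂˣ) (L : Subgroup G) (l x : L) :
    indChar χ L (l * x * l⁻¹) = indChar χ L x := by
  classical
  unfold indChar
  congr 1
  refine Fintype.sum_equiv (Equiv.mulLeft l⁻¹) _ _ fun y => ?_
  have h : (y : G)⁻¹ * ((l * x * l⁻¹ : L) : G) * (y : G) =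
      ((Equiv.mulLeft l⁻¹ y : L) : G)⁻¹ * (x : G) * ((Equiv.mulLeft l⁻¹ y : L) : G) := by
    simp [mul_assoc]
  simp only [h]

theorem single_mul_eQ (χ : H →* ℂˣ) (L : Subgroup G) (l : L) :
    MonoidAlgebra.single (l : G) 1 * eQ χ L = eQ χ L * MonoidAlgebra.single (l : G) 1 := by
  classical
  unfold eQ
  rw [mul_smul_comm, smul_mul_assoc, Finset.mul_sum, Finset.sum_mul]
  congr 1
  refine Fintype.sum_equiv (MulAut.conj l).toEquiv _ _ fun x => ?_
  have h : charValue χ L (l * x * l⁻¹) = charValue χ L x := Subtype.ext (indChar_conj χ L l x)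
  have h' : (MulAut.conj l).toEquiv x = l * x * l⁻¹ := rfl
  rw [h', h]
  simp [MonoidAlgebra.single_mul_single, mul_assoc]

theorem mul_eQ (χ : H →* ℂˣ) (L : Subgroup G) {a : MonoidAlgebra ℚ G}
    (ha : a ∈ groupSubalgebra L) : a * eQ χ L = eQ χ L * a := by
  obtain ⟨b, rfl⟩ := ha
  induction b using MonoidAlgebra.induction_linear with
  | zero => simp
  | add f g hf hg => rw [map_add, add_mul, mul_add, hf, hg]
  | single m r =>
    have h : (MonoidAlgebra.single (m : G) r : MonoidAlgebra ℚ G) =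
        r • MonoidAlgebra.single (m : G) 1 := by simp
    simp only [AlgHom.toRingHom_eq_coe, RingHom.coe_coe, MonoidAlgebra.mapDomainAlgHom_apply,
      MonoidAlgebra.mapDomain_single, Subgroup.subtype_apply]
    rw [h, smul_mul_assoc, mul_smul_comm, single_mul_eQ]

/-- The component `ℚL e_ℚ(χ^L) = {a e_ℚ(χ^L) : a ∈ ℚL}`; its unit is `e_ℚ(χ^L)`, so it is only
a non-unital subalgebra of `ℚG`. -/
def component (χ : H →* ℂˣ) (L : Subgroup G) : NonUnitalSubalgebra ℚ (MonoidAlgebra ℚ G) where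
  carrier := {x | ∃ a ∈ groupSubalgebra L, x = a * eQ χ L}
  zero_mem' := ⟨0, zero_mem _, by simp⟩
  add_mem' := by
    rintro _ _ ⟨a, ha, rfl⟩ ⟨b, hb, rfl⟩
    exact ⟨a + b, add_mem ha hb, (add_mul _ _ _).symm⟩
  mul_mem' := by
    rintro _ _ ⟨a, ha, rfl⟩ ⟨b, hb, rfl⟩
    exact ⟨a * eQ χ L * b, mul_mem (mul_mem ha (eQ_mem χ L)) hb, by simp only [mul_assoc]⟩
  smul_mem' := by
    rintro r _ ⟨a, ha, rfl⟩
    exact ⟨r • a, Subalgebra.smul_mem _ ha r, (smul_mul_assoc _ _ _).symm⟩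

/-- The center of `ℚL e_ℚ(χ^L)`. -/
abbrev componentCenter (χ : H →* ℂˣ) (L : Subgroup G) : NonUnitalSubalgebra ℚ (component χ L) :=
  NonUnitalSubalgebra.center ℚ (component χ L)

/-- The subalgebra of the center of `ℚL e_ℚ(χ^L)` fixed by conjugation by all elements of `C`.
When `L ⊴ C` and `C` centralizes `e_ℚ(χ^L)`, the group `C` acts on `ℚL e_ℚ(χ^L)` by conjugation
and `L` acts trivially on the center, so this is the fixed subring under `C / L`. -/
def fixedCenter (χ : H →* ℂˣ) (L C : Subgroup G) : NonUnitalSubalgebra ℚ (component χ L) where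
  carrier := {z | z ∈ componentCenter χ L ∧
    ∀ c ∈ C, conj (z : MonoidAlgebra ℚ G) c = (z : MonoidAlgebra ℚ G)}
  zero_mem' := ⟨zero_mem _, by simp [conj]⟩
  add_mem' := by
    rintro x y ⟨hx, hx'⟩ ⟨hy, hy'⟩
    refine ⟨add_mem hx hy, fun c hc => ?_⟩
    have h := congrArg₂ (· + ·) (hx' c hc) (hy' c hc)
    simpa [conj, mul_add, add_mul] using h
  mul_mem' := by
    rintro x y ⟨hx, hx'⟩ ⟨hy, hy'⟩
    refine ⟨mul_mem hx hy, fun c hc => ?_⟩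
    have h := congrArg₂ (· * ·) (hx' c hc) (hy' c hc)
    simpa [conj_mul] using h
  smul_mem' := by
    rintro r x ⟨hx, hx'⟩
    refine ⟨SMulMemClass.smul_mem r hx, fun c hc => ?_⟩
    have h := congrArg (r • ·) (hx' c hc)
    simpa [conj] using h

/-- `H = N 0 ≤ N 1 ≤ ⋯ ≤ N n = G` is a strong inductive chain from `H` to `G`, for the linear
character `χ` of `H`: for all `i < n`, `N i` is a normal subgroup of `Cen_{N (i+1)}(e_ℚ(χ^{N i}))`
and the distinct `N (i+1)`-conjugates of `e_ℚ(χ^{N i})` are mutually orthogonal. -/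
structure IsStrongInductiveChain (χ : H →* ℂˣ) {n : ℕ} (N : Fin (n + 1) → Subgroup G) : Prop where
  bot : N 0 = H
  top : N (Fin.last n) = ⊤
  step : ∀ i : Fin n, N i.castSucc ≤ N i.succ
  le_cen : ∀ i : Fin n, N i.castSucc ≤ cen (N i.succ) (eQ χ (N i.castSucc))
  normal : ∀ i : Fin n,
    ((N i.castSucc).subgroupOf (cen (N i.succ) (eQ χ (N i.castSucc)))).Normal
  orthogonal : ∀ i : Fin n, ∀ g ∈ N i.succ, ∀ h ∈ N i.succ,
    conj (eQ χ (N i.castSucc)) g ≠ conj (eQ χ (N i.castSucc)) h →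
      conj (eQ χ (N i.castSucc)) g * conj (eQ χ (N i.castSucc)) h = 0

/-- `(H, K)` is a generalized strong Shoda pair of `G`: a Shoda pair such that there is a strong
inductive chain from `H` to `G` for a linear character `χ` of `H` with kernel `K`. -/
def IsGeneralizedStrongShodaPair (H K : Subgroup G) : Prop :=
  IsShodaPair H K ∧ ∃ χ : H →* ℂˣ, χ.ker = K.subgroupOf H ∧
    ∃ (n : ℕ) (N : Fin (n + 1) → Subgroup G), IsStrongInductiveChain χ N

/-- The least center property with respect to the chain `N`: for all `i < n`, with
`e = e_ℚ(χ^{N i})` and `C = Cen_{N (i+1)}(e)`, the center of `ℚN(i+1) e_ℚ(χ^{N (i+1)})` is the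
subring of the center of `ℚN(i) e` fixed by `C / N i`. The two centers lie in different corners of
`ℚG`, and the identification is `z ↦ z e`: the component of `N (i+1)` is a matrix algebra over its
corner `ℚC e`, a crossed product of `ℚN(i) e` by `C / N i`, and on the center of the matrix algebra,
the scalar matrices with entry in the center of `ℚC e`, reading off the entry is `z ↦ z e`. -/
def HasLeastCenterProperty (χ : H →* ℂˣ) {n : ℕ} (N : Fin (n + 1) → Subgroup G) : Prop :=
  ∀ i : Fin n, ∃ Φ : componentCenter χ (N i.succ) ≃+*
      fixedCenter χ (N i.castSucc) (cen (N i.succ) (eQ χ (N i.castSucc))),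
    ∀ z : componentCenter χ (N i.succ),
      ((Φ z : component χ (N i.castSucc)) : MonoidAlgebra ℚ G) =
        ((z : component χ (N i.succ)) : MonoidAlgebra ℚ G) * eQ χ (N i.castSucc)

end Component

end ShodaTheory

end

/-!
Let `ε = |H|⁻¹ ∑_{h ∈ H} χ(h) h⁻¹ ∈ ℂH`. The Shoda condition says exactly that `ε g ε = 0` for
`g ∉ H` (`linIdem_mul_single_mul_linIdem`), so the corner `ε ℂG ε` is `ℂ ε` and every element
commuting with `H` acts on `ε` by a scalar. For `H ≤ L` the sum `p_L` of the conjugates of `ε` over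
the cosets of `H` in `L` is `|H|⁻¹ ∑_{x ∈ L} χ^L(x) x⁻¹`; it is an idempotent commuting with `L`,
with `p_L ε = ε`, and every `z ∈ ℂG` commuting with `L` acts on `p_L` by the same scalar as on `ε`.
These facts replace the irreducibility of `χ^L`.

The element `e_L = e_ℚ(χ^L)` is the coefficientwise trace of `p_L`. The trace is linear over `ℚG`,
so an `a ∈ ℚG` with `a p_L = p_L` satisfies `a e_L = e_L`; for `a` commuting with `L` it is enough
that `a ε = ε` (`mul_eQ_eq_self`). Over `ℂ`, `e_L` is the sum of the `σ(p_L)` over the embeddings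
`σ` of the character field in `ℂ`. Each `σ(p_L)` belongs to a linear character with the same
kernel, and it kills `ε` unless `σ` is the inclusion, so `e_L ε = ε` (`toComplex_eQ_mul_linIdem`).
It follows that `e_L` is idempotent, that `e_M e_L = e_L` for `L ≤ M`, and, if the distinct
`M`-conjugates of `e_L` are orthogonal, that `e_M` is their sum (`conjSum_eQ`).

Now let `L ≤ M` be a step of the chain, `e = e_L` and `C = Cen_M(e)`. If `z ∈ ℚM` is central, then
`z p_L` is a scalar multiple of `p_L`, hence supported on `L`, and so is its trace `z e`
(`mul_eQ_mem`). Thus `z ↦ z e` takes values in the center of `ℚL e`, and they are fixed by `C`.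
Conversely the sum of the conjugates of `w` over the cosets of `C` in `M` is central in `ℚM e_M`
for every `C`-fixed `w` in the center of `ℚL e`, and this is the inverse map, by orthogonality of
the conjugates of `e` and because `e_M` is their sum (`exists_componentCenter_equiv`).
-/

open MonoidAlgebra

namespace ShodaTheory

variable {G : Type*} [Group G] {H : Subgroup G}

/-! ### The Shoda condition for a linear character -/

/-- A linear character `χ` of `H` separates `H` from the rest of the group: every `g ∉ H` has a
commutator `h⁻¹ g⁻¹ h g ∈ H` with `h ∈ H` on which `χ` is nontrivial. This is the commutator
condition in the definition of a Shoda pair `(H, ker χ)`. -/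
def IsSeparating (χ : H →* ℂˣ) : Prop :=
  ∀ g : G, g ∉ H → ∃ h k : H, (h : G)⁻¹ * g⁻¹ * h * g = k ∧ χ k ≠ 1

theorem IsShodaPair.isSeparating {K : Subgroup G} (hHK : IsShodaPair H K) {χ : H →* ℂˣ}
    (hχ : χ.ker = K.subgroupOf H) : IsSeparating χ := by
  intro g hg
  by_contra! hc
  refine hg (hHK.mem_of_commutators g fun h hh hk => ?_)
  have h1 : (⟨_, hk⟩ : H) ∈ χ.ker := MonoidHom.mem_ker.2 (hc ⟨h, hh⟩ ⟨_, hk⟩ rfl)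
  rw [hχ] at h1
  exact Subgroup.mem_subgroupOf.1 h1

/-! ### The idempotents of a linear character and of its induced characters -/

section Idempotents

variable [Fintype G]

open Classical in
/-- The primitive idempotent `|H|⁻¹ ∑_{h ∈ H} χ(h) h⁻¹` of `ℂH` attached to a linear
character `χ` of `H`, as an element of `ℂG`. -/
noncomputable def linIdem (χ : H →* ℂˣ) : MonoidAlgebra ℂ G :=
  (Nat.card H : ℂ)⁻¹ • ∑ h : H, single ((h : G)⁻¹) (χ h : ℂ)

open Classical in
/-- The element `|H|⁻¹ ∑_{x ∈ L} χ^L(x) x⁻¹` of `ℂG`. When `χ^L` is irreducible, it is the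
central idempotent of `ℂL` attached to `χ^L`, since `χ^L(1) = |L| / |H|`. -/
noncomputable def charIdem (χ : H →* ℂˣ) (L : Subgroup G) : MonoidAlgebra ℂ G :=
  (Nat.card H : ℂ)⁻¹ • ∑ x : L, single ((x : G)⁻¹) (indChar χ L x)

theorem single_mul_linIdem (χ : H →* ℂˣ) (h : H) :
    single (h : G) 1 * linIdem χ = (χ h : ℂ) • linIdem χ := by
  classical
  unfold linIdem
  rw [mul_smul_comm, Finset.mul_sum, smul_comm, Finset.smul_sum (r := (χ h : ℂ))]
  refine congrArg _ (Fintype.sum_equiv (Equiv.mulRight h⁻¹) _ _ fun k => ?_)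
  have h0 := (χ h).ne_zero
  simp only [single_mul_single, one_mul, Equiv.coe_mulRight, smul_single, smul_eq_mul, map_mul,
    map_inv, Units.val_mul, Units.val_inv_eq_inv_val, Subgroup.coe_mul, Subgroup.coe_inv, mul_inv_rev,
    inv_inv]
  field_simp

theorem linIdem_mul_single (χ : H →* ℂˣ) (h : H) :
    linIdem χ * single (h : G) 1 = (χ h : ℂ) • linIdem χ := by
  classical
  unfold linIdem
  rw [smul_mul_assoc, Finset.sum_mul, smul_comm, Finset.smul_sum (r := (χ h : ℂ))]
  refine congrArg _ (Fintype.sum_equiv (Equiv.mulLeft h⁻¹) _ _ fun k => ?_)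
  simp [single_mul_single]

theorem linIdem_mul_self (χ : H →* ℂˣ) : linIdem χ * linIdem χ = linIdem χ := by
  classical
  have key (k : H) : single ((k : G)⁻¹) (χ k : ℂ) * linIdem χ = linIdem χ := by
    have h := single_mul_linIdem χ k⁻¹
    have e : (single ((k : G)⁻¹) (χ k : ℂ) : MonoidAlgebra ℂ G) =
        (χ k : ℂ) • single ((k⁻¹ : H) : G) 1 := by simp
    rw [e, smul_mul_assoc, h, smul_smul]
    simp
  conv_lhs => enter [1]; unfold linIdem
  rw [smul_mul_assoc, Finset.sum_mul, Finset.sum_congr rfl fun k _ => key k, Finset.sum_const,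
    Finset.card_univ, ← Nat.card_eq_fintype_card, ← Nat.cast_smul_eq_nsmul ℂ, smul_smul,
    inv_mul_cancel₀ (Nat.cast_ne_zero.2 Nat.card_pos.ne'), one_smul]

theorem linIdem_ne_zero (χ : H →* ℂˣ) : linIdem χ ≠ 0 := by
  classical
  intro h
  have h1 := congrArg (fun a : MonoidAlgebra ℂ G => a.coeff 1) h
  simp only [linIdem, coeff_smul_apply, coeff_sum, Finsupp.finsetSum_apply, coeff_single,
    Finsupp.single_apply, coeff_zero, Finsupp.coe_zero, Pi.zero_apply, inv_eq_one,
    OneMemClass.coe_eq_one, Finset.sum_ite_eq', Finset.mem_univ, if_true, map_one] at h1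
  simp at h1

/-- Mackey's criterion in terms of idempotents: if `χ` is nontrivial on a commutator
`h⁻¹ g⁻¹ h g`, then `h` acts on `ε g ε` by two different scalars. -/
theorem linIdem_mul_single_mul_linIdem {χ : H →* ℂˣ} (hs : IsSeparating χ) {g : G} (hg : g ∉ H) :
    linIdem χ * single g 1 * linIdem χ = 0 := by
  obtain ⟨h, k, hk, hne⟩ := hs g hg
  have hgk : (h : G) * g = g * (h * k : H) := by
    rw [Subgroup.coe_mul, ← hk]; group
  have h1 : linIdem χ * single ((h : G) * g) 1 * linIdem χ =
      (χ h : ℂ) • (linIdem χ * single g 1 * linIdem χ) := by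
    rw [show (single ((h : G) * g) 1 : MonoidAlgebra ℂ G) = single (h : G) 1 * single g 1 by
      simp [single_mul_single], ← mul_assoc, linIdem_mul_single, smul_mul_assoc, smul_mul_assoc]
  have h2 : linIdem χ * single (g * (h * k : H)) 1 * linIdem χ =
      (χ (h * k) : ℂ) • (linIdem χ * single g 1 * linIdem χ) := by
    rw [show (single (g * (h * k : H)) 1 : MonoidAlgebra ℂ G) =
      single g 1 * single ((h * k : H) : G) 1 by simp [single_mul_single], ← mul_assoc,
      mul_assoc _ _ (linIdem χ), single_mul_linIdem, mul_smul_comm]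
  rw [hgk, h2, ← sub_eq_zero, ← sub_smul, smul_eq_zero, sub_eq_zero] at h1
  refine h1.resolve_left fun h3 => hne ?_
  have h4 := Units.ext h3
  rwa [map_mul, mul_eq_left] at h4

/-- The idempotent `ε` of a separating character is primitive in `ℂG`: its corner is `ℂ ε`. -/
theorem exists_linIdem_mul_mul_linIdem {χ : H →* ℂˣ} (hs : IsSeparating χ)
    (a : MonoidAlgebra ℂ G) : ∃ c : ℂ, linIdem χ * a * linIdem χ = c • linIdem χ := by
  induction a using MonoidAlgebra.induction_linear with
  | zero => exact ⟨0, by simp⟩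
  | add a b ha hb =>
    obtain ⟨c, hc⟩ := ha
    obtain ⟨d, hd⟩ := hb
    exact ⟨c + d, by rw [mul_add, add_mul, hc, hd, add_smul]⟩
  | single g r =>
    have e : (single g r : MonoidAlgebra ℂ G) = r • single g 1 := by simp
    rw [e, mul_smul_comm, smul_mul_assoc]
    by_cases hg : g ∈ H
    · refine ⟨r * χ ⟨g, hg⟩, ?_⟩
      rw [linIdem_mul_single χ ⟨g, hg⟩, smul_mul_assoc, linIdem_mul_self, smul_smul]
    · exact ⟨0, by rw [linIdem_mul_single_mul_linIdem hs hg]; simp⟩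

theorem commute_linIdem (χ : H →* ℂˣ) {z : MonoidAlgebra ℂ G}
    (hz : ∀ h ∈ H, Commute (single h 1) z) : Commute (linIdem χ) z := by
  classical
  refine Commute.smul_left (Commute.sum_left _ _ _ fun h _ => ?_) _
  have e : (single ((h : G)⁻¹) (χ h : ℂ) : MonoidAlgebra ℂ G) =
      (χ h : ℂ) • single ((h : G)⁻¹) 1 := by simp
  rw [e]
  exact (hz _ (inv_mem h.2)).smul_left _

theorem exists_mul_linIdem {χ : H →* ℂˣ} (hs : IsSeparating χ) {z : MonoidAlgebra ℂ G}
    (hz : ∀ h ∈ H, Commute (single h 1) z) : ∃ c : ℂ, z * linIdem χ = c • linIdem χ := by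
  obtain ⟨c, hc⟩ := exists_linIdem_mul_mul_linIdem hs z
  refine ⟨c, ?_⟩
  rw [← hc, (commute_linIdem χ hz).eq, mul_assoc, linIdem_mul_self]

open Classical in
/-- `charIdem χ L` is the sum of the conjugates of `linIdem χ` over the cosets of `H` in `L`: each
coset contributes `|H|` equal terms to the sum over `L`. -/
theorem charIdem_eq_sum_conj (χ : H →* ℂˣ) {L : Subgroup G} (hL : H ≤ L) :
    charIdem χ L = (Nat.card H : ℂ)⁻¹ • ∑ y : L,
      single (y : G) 1 * linIdem χ * single ((y : G)⁻¹) 1 := by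
  classical
  have key (y : L) : single (y : G) 1 * linIdem χ * single ((y : G)⁻¹) 1 =
      (Nat.card H : ℂ)⁻¹ • ∑ x : L, (single ((x : G)⁻¹)
        (if hy : (y : G)⁻¹ * (x : G) * (y : G) ∈ H then
          ((χ ⟨(y : G)⁻¹ * (x : G) * (y : G), hy⟩ : ℂˣ) : ℂ) else 0) : MonoidAlgebra ℂ G) := by
    unfold linIdem
    rw [mul_smul_comm, smul_mul_assoc, Finset.mul_sum, Finset.sum_mul]
    refine congrArg _ (Finset.sum_of_injOn (fun h : H => y * ⟨h, hL h.2⟩ * y⁻¹) ?_ ?_ ?_ ?_)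
    · intro h _ k _ hhk
      simpa using hhk
    · simp
    · intro x _ hx
      -- only the `x ∈ y H y⁻¹` contribute
      rw [dif_neg, single_zero]
      intro hy
      exact hx ⟨⟨_, hy⟩, Finset.mem_coe.2 (Finset.mem_univ _), by ext; simp [mul_assoc]⟩
    · intro h _
      have e : (y : G)⁻¹ * ((y * ⟨h, hL h.2⟩ * y⁻¹ : L) : G) * (y : G) = h := by
        simp [mul_assoc]
      have hm : (y : G)⁻¹ * ((y * ⟨h, hL h.2⟩ * y⁻¹ : L) : G) * (y : G) ∈ H := by
        rw [e]; exact h.2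
      have e' : (⟨_, hm⟩ : H) = h := Subtype.ext e
      rw [dif_pos hm, e']
      simp [single_mul_single, mul_assoc]
  rw [Finset.sum_congr rfl fun y _ => key y, ← Finset.smul_sum, Finset.sum_comm, charIdem]
  refine congrArg _ ?_
  rw [Finset.smul_sum]
  refine Finset.sum_congr rfl fun x _ => ?_
  rw [indChar, ← smul_eq_mul, ← smul_single]
  exact congrArg _ (map_sum (singleAddHom (R := ℂ) ((x : G)⁻¹)) _ _)

theorem commute_charIdem (χ : H →* ℂˣ) {L : Subgroup G} (hL : H ≤ L) {l : G} (hl : l ∈ L) :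
    Commute (single l 1) (charIdem χ L) := by
  classical
  rw [charIdem_eq_sum_conj χ hL]
  refine Commute.smul_right ?_ _
  rw [Commute, SemiconjBy, Finset.mul_sum, Finset.sum_mul]
  refine Fintype.sum_equiv (Equiv.mulLeft (⟨l, hl⟩ : L)) _ _ fun y => ?_
  have e1 : (single (l * y) 1 : MonoidAlgebra ℂ G) = single l 1 * single (y : G) 1 := by
    simp [single_mul_single]
  have e2 : (single ((l * y)⁻¹) 1 * single l 1 : MonoidAlgebra ℂ G) = single (y : G)⁻¹ 1 := by
    simp [single_mul_single]
  simp only [Equiv.coe_mulLeft, Subgroup.coe_mul]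
  rw [mul_assoc (_ * _), e2, e1]
  simp only [mul_assoc]

/-- An element commuting with `L` acts on `charIdem χ L`, a sum of `L`-conjugates of `linIdem χ`,
by the same scalar as on `linIdem χ`. -/
theorem mul_charIdem (χ : H →* ℂˣ) {L : Subgroup G} (hL : H ≤ L) {z : MonoidAlgebra ℂ G}
    (hz : ∀ l ∈ L, Commute (single l 1) z) {c : ℂ} (hc : z * linIdem χ = c • linIdem χ) :
    z * charIdem χ L = c • charIdem χ L := by
  rw [charIdem_eq_sum_conj χ hL, mul_smul_comm, Finset.mul_sum, smul_comm, Finset.smul_sum (r := c)]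
  refine congrArg _ (Finset.sum_congr rfl fun y _ => ?_)
  rw [← mul_assoc, ← mul_assoc, ← (hz y y.2).eq, mul_assoc _ z, hc]
  simp

theorem charIdem_mul_linIdem {χ : H →* ℂˣ} (hs : IsSeparating χ) {L : Subgroup G} (hL : H ≤ L) :
    charIdem χ L * linIdem χ = linIdem χ := by
  classical
  have key (y : L) : single (y : G) 1 * linIdem χ * single ((y : G)⁻¹) 1 * linIdem χ =
      if (y : G) ∈ H then linIdem χ else 0 := by
    rw [mul_assoc, mul_assoc, ← mul_assoc (linIdem χ)]
    split_ifs with hy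
    · have h := single_mul_linIdem χ ⟨y, hy⟩
      have h' := linIdem_mul_single χ ⟨y, hy⟩⁻¹
      simp only [Subgroup.coe_inv] at h'
      rw [h', smul_mul_assoc, linIdem_mul_self, mul_smul_comm, h, smul_smul]
      simp
    · rw [linIdem_mul_single_mul_linIdem hs fun h => hy (inv_mem_iff.1 h), mul_zero]
  rw [charIdem_eq_sum_conj χ hL, smul_mul_assoc, Finset.sum_mul,
    Finset.sum_congr rfl fun y _ => key y, ← Finset.sum_filter, Finset.sum_const]
  have hcard : (Finset.univ.filter fun y : L => (y : G) ∈ H).card = Nat.card H := by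
    rw [← Fintype.card_subtype, ← Nat.card_eq_fintype_card]
    exact Nat.card_congr (Subgroup.subgroupOfEquivOfLe hL).toEquiv
  rw [hcard, ← Nat.cast_smul_eq_nsmul ℂ, smul_smul,
    inv_mul_cancel₀ (Nat.cast_ne_zero.2 Nat.card_pos.ne'), one_smul]

theorem charIdem_mul_self {χ : H →* ℂˣ} (hs : IsSeparating χ) {L : Subgroup G} (hL : H ≤ L) :
    charIdem χ L * charIdem χ L = charIdem χ L := by
  have h := mul_charIdem χ hL (fun l hl => commute_charIdem χ hL hl) (c := 1)
    (by rw [charIdem_mul_linIdem hs hL, one_smul])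
  rwa [one_smul] at h

theorem charIdem_ne_zero {χ : H →* ℂˣ} (hs : IsSeparating χ) {L : Subgroup G} (hL : H ≤ L) :
    charIdem χ L ≠ 0 := by
  intro h
  have h1 := charIdem_mul_linIdem hs hL
  rw [h, zero_mul] at h1
  exact linIdem_ne_zero χ h1.symm

/-- Orthogonality of distinct irreducible characters: the idempotent of another one kills
`charIdem χ L`, and hence `linIdem χ`. -/
theorem charIdem_mul_linIdem_eq_zero {χ ψ : H →* ℂˣ} (hχ : IsSeparating χ) (hψ : IsSeparating ψ)
    {L : Subgroup G} (hL : H ≤ L) (hne : charIdem ψ L ≠ charIdem χ L) :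
    charIdem ψ L * linIdem χ = 0 := by
  have comm {φ : H →* ℂˣ} : ∀ h ∈ H, Commute (single h 1) (charIdem φ L) :=
    fun h hh => commute_charIdem φ hL (hL hh)
  obtain ⟨c, hc⟩ := exists_mul_linIdem hχ (comm (φ := ψ))
  obtain ⟨d, hd⟩ := exists_mul_linIdem hψ (comm (φ := χ))
  have hc' := mul_charIdem χ hL (fun l hl => commute_charIdem ψ hL hl) hc
  have hd' := mul_charIdem ψ hL (fun l hl => commute_charIdem χ hL hl) hd
  by_contra h0
  have hc0 : c ≠ 0 := by
    rintro rfl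
    exact h0 (by rw [hc, zero_smul])
  classical
  -- `c • p = d • q` for the idempotents `p = charIdem χ L` and `q = charIdem ψ L`
  have eq1 : c • charIdem χ L = d • charIdem ψ L := by
    rw [← hc', ← hd']
    have e : charIdem χ L = (Nat.card H : ℂ)⁻¹ • ∑ x : L,
        indChar χ L x • single ((x : G)⁻¹) (1 : ℂ) := by simp [charIdem]
    refine Commute.eq (Commute.symm ?_)
    rw [e]
    exact (Commute.sum_left _ _ _ fun x _ =>
      (commute_charIdem ψ hL (inv_mem x.2)).smul_left _).smul_left _
  -- multiplying by `q` and by `p` gives `c² = c` and `d² = d`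
  have hc1 : c = 1 := by
    have h := congrArg (charIdem ψ L * ·) eq1
    simp only [mul_smul_comm, charIdem_mul_self hψ hL, hc'] at h
    rw [← eq1, smul_smul] at h
    have h' := smul_left_injective ℂ (charIdem_ne_zero hχ hL) h
    exact (mul_eq_left₀ hc0).1 h'
  rw [hc1, one_smul] at eq1
  have hd0 : d ≠ 0 := by
    rintro rfl
    exact charIdem_ne_zero hχ hL (by rw [eq1, zero_smul])
  have hd1 : d = 1 := by
    have h := congrArg (charIdem χ L * ·) eq1
    simp only [mul_smul_comm, charIdem_mul_self hχ hL, hd', smul_smul] at h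
    rw [eq1] at h
    have h' := smul_left_injective ℂ (charIdem_ne_zero hψ hL) h
    exact (left_eq_mul₀ hd0).1 h'
  exact hne (by rw [eq1, hd1, one_smul])

end Idempotents

/-! ### The rational idempotent as a trace -/

/-- The inclusion `ℚG → ℂG`. -/
noncomputable abbrev toComplex : MonoidAlgebra ℚ G →+* MonoidAlgebra ℂ G :=
  mapRingHom G (algebraMap ℚ ℂ)

/-- The coefficientwise trace to `ℚ` is linear over `ℚG`. -/
theorem map_trace_mul {k : Type*} [Field k] [Algebra ℚ k] (a : MonoidAlgebra ℚ G)
    (x : MonoidAlgebra k G) :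
    MonoidAlgebra.map (Algebra.trace ℚ k).toAddMonoidHom (mapRingHom G (algebraMap ℚ k) a * x) =
      a * MonoidAlgebra.map (Algebra.trace ℚ k).toAddMonoidHom x := by
  induction a using MonoidAlgebra.induction_linear with
  | zero => simp [MonoidAlgebra.map_zero]
  | add a b ha hb => rw [map_add, add_mul, MonoidAlgebra.map_add, ha, hb, add_mul]
  | single g r =>
    induction x using MonoidAlgebra.induction_linear with
    | zero => simp [MonoidAlgebra.map_zero]
    | add x y hx hy => rw [mul_add, MonoidAlgebra.map_add, hx, hy, MonoidAlgebra.map_add, mul_add]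
    | single h c =>
      rw [mapRingHom_single, single_mul_single, map_single, map_single, single_mul_single,
        ← Algebra.smul_def]
      exact congrArg _ (map_smul (Algebra.trace ℚ k) r c)

theorem commute_toComplex {a : MonoidAlgebra ℚ G} {g : G} (h : Commute (single g 1) a) :
    Commute (single g 1) (toComplex a) := by
  have := h.map toComplex
  rwa [mapRingHom_single, map_one] at this

theorem mem_groupSubalgebra_of_coeff {L : Subgroup G} {a : MonoidAlgebra ℚ G}
    (h : ∀ g, g ∉ L → a.coeff g = 0) : a ∈ groupSubalgebra L := by
  refine ⟨comapDomain L.subtype Subtype.val_injective a, mapDomain_comapDomain ?_ _⟩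
  intro g hg
  by_contra hgL
  exact Finsupp.mem_support_iff.1 hg (h g fun hL => hgL ⟨⟨g, hL⟩, rfl⟩)

section Trace

variable [Fintype G]

/-- The element `|H|⁻¹ ∑_{x ∈ L} χ^L(x) x⁻¹` with coefficients in the character field. -/
noncomputable def charIdemField (χ : H →* ℂˣ) (L : Subgroup G) :
    MonoidAlgebra (charField χ L) G :=
  letI := Classical.propDecidable
  ∑ x : L, single ((x : G)⁻¹) ((Nat.card H : charField χ L)⁻¹ * charValue χ L x)

theorem indChar_mem_adjoin (χ : H →* ℂˣ) (L : Subgroup G) (x : L) :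
    indChar χ L x ∈ IntermediateField.adjoin ℚ (Set.range fun h : H => (χ h : ℂ)) := by
  classical
  unfold indChar
  refine mul_mem (inv_mem (natCast_mem _ _)) (sum_mem fun y _ => ?_)
  split_ifs with hy
  · exact IntermediateField.subset_adjoin ℚ _ ⟨_, rfl⟩
  · exact zero_mem _

theorem isIntegral_linChar (χ : H →* ℂˣ) (h : H) : IsIntegral ℚ (χ h : ℂ) := by
  refine IsIntegral.of_pow (n := Nat.card H) Nat.card_pos ?_
  rw [← Units.val_pow_eq_pow_val, ← map_pow, pow_card_eq_one', map_one]
  exact isIntegral_one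

theorem charField_le (χ : H →* ℂˣ) (L : Subgroup G) :
    charField χ L ≤ IntermediateField.adjoin ℚ (Set.range fun h : H => (χ h : ℂ)) :=
  IntermediateField.adjoin_le_iff.2 (by rintro _ ⟨x, rfl⟩; exact indChar_mem_adjoin χ L x)

instance finiteDimensional_charField (χ : H →* ℂˣ) (L : Subgroup G) :
    FiniteDimensional ℚ (charField χ L) := by
  have : FiniteDimensional ℚ (IntermediateField.adjoin ℚ (Set.range fun h : H => (χ h : ℂ))) :=
    IntermediateField.finiteDimensional_adjoin (by rintro _ ⟨h, rfl⟩; exact isIntegral_linChar χ h)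
  exact FiniteDimensional.of_injective (IntermediateField.inclusion (charField_le χ L)).toLinearMap
    (IntermediateField.inclusion (charField_le χ L)).injective

/-- Every embedding of the character field of `χ^L` in `ℂ` extends to the field of values of `χ`,
so that the Galois conjugates of `χ^L` are induced from linear characters of `H` again. -/
theorem exists_linChar_indChar_eq {χ : H →* ℂˣ} (hs : IsSeparating χ) (L : Subgroup G)
    (σ : charField χ L →ₐ[ℚ] ℂ) :
    ∃ ψ : H →* ℂˣ, IsSeparating ψ ∧ ∀ x, indChar ψ L x = σ (charValue χ L x) := by
  classical
  obtain ⟨φ, hφ⟩ := IntermediateField.exists_algHom_adjoin_of_splits (K := ℂ)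
    (S := Set.range fun h : H => (χ h : ℂ))
    (by rintro _ ⟨h, rfl⟩; exact ⟨isIntegral_linChar χ h, IsAlgClosed.splits _⟩) σ
    (charField_le χ L)
  have hmem (h : H) : (χ h : ℂ) ∈
      IntermediateField.adjoin ℚ (Set.range fun h : H => (χ h : ℂ)) :=
    IntermediateField.subset_adjoin ℚ _ ⟨h, rfl⟩
  let ψ : H →* ℂˣ := MonoidHom.toHomUnits
    { toFun := fun h => φ ⟨χ h, hmem h⟩
      map_one' := by rw [← map_one φ]; congr 1; ext; simp
      map_mul' := fun a b => by rw [← map_mul]; congr 1; ext; simp }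
  have hψ (h : H) : (ψ h : ℂ) = φ ⟨χ h, hmem h⟩ := rfl
  refine ⟨ψ, fun g hg => ?_, fun x => ?_⟩
  · obtain ⟨h, k, hk, hne⟩ := hs g hg
    refine ⟨h, k, hk, fun h1 => hne (Units.ext ?_)⟩
    have h2 : φ ⟨χ k, hmem k⟩ = φ 1 := by rw [← hψ, h1, map_one]; rfl
    exact congrArg Subtype.val (φ.injective h2)
  · have hφ' : φ (IntermediateField.inclusion (charField_le χ L) (charValue χ L x)) =
        σ (charValue χ L x) := DFunLike.congr_fun hφ _
    rw [← hφ']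
    have e : IntermediateField.inclusion (charField_le χ L) (charValue χ L x) =
        (Nat.card H : IntermediateField.adjoin ℚ (Set.range fun h : H => (χ h : ℂ)))⁻¹ *
        ∑ y : L, if hy : (y : G)⁻¹ * (x : G) * (y : G) ∈ H then
          ⟨χ ⟨(y : G)⁻¹ * (x : G) * (y : G), hy⟩, hmem _⟩ else 0 := by
      ext
      simp only [IntermediateField.coe_inclusion, charValue, indChar, IntermediateField.coe_mul,
        IntermediateField.coe_inv, IntermediateField.coe_sum]
      congr 1
      refine Finset.sum_congr rfl fun y _ => ?_
      split_ifs <;> rfl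
    rw [e, map_mul, map_inv₀, map_natCast, map_sum, indChar]
    congr 1
    refine Finset.sum_congr rfl fun y _ => ?_
    split_ifs
    · rfl
    · rw [map_zero]

theorem map_val_charIdemField (χ : H →* ℂˣ) (L : Subgroup G) :
    mapRingHom G (charField χ L).val.toRingHom (charIdemField χ L) = charIdem χ L := by
  classical
  rw [charIdemField, charIdem, map_sum, Finset.smul_sum]
  refine Finset.sum_congr rfl fun x _ => ?_
  rw [mapRingHom_single, smul_single, map_mul, map_inv₀, map_natCast]
  rfl

theorem map_trace_charIdemField (χ : H →* ℂˣ) (L : Subgroup G) :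
    MonoidAlgebra.map (Algebra.trace ℚ (charField χ L)).toAddMonoidHom (charIdemField χ L) =
      eQ χ L := by
  classical
  rw [charIdemField, eQ, MonoidAlgebra.map_sum, Finset.smul_sum]
  refine Finset.sum_congr rfl fun x _ => ?_
  rw [map_single, smul_single, ← map_smul, Algebra.smul_def, map_inv₀, map_natCast]
  rfl

theorem mul_eQ_eq_map_trace (χ : H →* ℂˣ) (L : Subgroup G) (a : MonoidAlgebra ℚ G) :
    a * eQ χ L = MonoidAlgebra.map (Algebra.trace ℚ (charField χ L)).toAddMonoidHom
      (mapRingHom G (algebraMap ℚ (charField χ L)) a * charIdemField χ L) := by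
  rw [map_trace_mul, map_trace_charIdemField]

theorem map_val_mul_charIdemField (χ : H →* ℂˣ) (L : Subgroup G) (a : MonoidAlgebra ℚ G) :
    mapRingHom G (charField χ L).val.toRingHom
      (mapRingHom G (algebraMap ℚ (charField χ L)) a * charIdemField χ L) =
      toComplex a * charIdem χ L := by
  rw [map_mul, map_val_charIdemField, ← RingHom.comp_apply, ← mapRingHom_comp]
  congr 3

theorem map_val_injective (χ : H →* ℂˣ) (L : Subgroup G) :
    Function.Injective (mapRingHom G (charField χ L).val.toRingHom) :=
  MonoidAlgebra.map_injective _ (charField χ L).val.toRingHom.injective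

/-- As `e_ℚ(χ^L)` is the trace of `charIdem χ L`, a rational element fixing the latter under left
multiplication fixes the former. -/
theorem mul_eQ_eq_self_of_mul_charIdem (χ : H →* ℂˣ) (L : Subgroup G) {a : MonoidAlgebra ℚ G}
    (ha : toComplex a * charIdem χ L = charIdem χ L) : a * eQ χ L = eQ χ L := by
  rw [mul_eQ_eq_map_trace, ← map_trace_charIdemField]
  congr 1
  apply map_val_injective
  rw [map_val_mul_charIdemField, ha, map_val_charIdemField]

theorem mul_eQ_eq_self (χ : H →* ℂˣ) {L : Subgroup G} (hL : H ≤ L) {a : MonoidAlgebra ℚ G}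
    (hz : ∀ l ∈ L, Commute (single l 1) a) (ha : toComplex a * linIdem χ = linIdem χ) :
    a * eQ χ L = eQ χ L := by
  refine mul_eQ_eq_self_of_mul_charIdem χ L ?_
  have h := mul_charIdem χ hL (fun l hl => commute_toComplex (hz l hl)) (c := 1)
    (by rw [ha, one_smul])
  rwa [one_smul] at h

/-- Over `ℂ`, the element `e_ℚ(χ^L)` is the sum of the Galois conjugates of `charIdem χ L`. -/
theorem toComplex_eQ (χ : H →* ℂˣ) (L : Subgroup G) :
    toComplex (eQ χ L) =
      ∑ σ : charField χ L →ₐ[ℚ] ℂ, mapRingHom G σ.toRingHom (charIdemField χ L) := by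
  classical
  have key (a : charField χ L) : algebraMap ℚ ℂ (Algebra.trace ℚ (charField χ L) a) =
      ∑ σ : charField χ L →ₐ[ℚ] ℂ, σ a := trace_eq_sum_embeddings ℂ
  ext g
  rw [← map_trace_charIdemField, coeff_sum, Finsupp.finsetSum_apply]
  simp only [coeff_mapRingHom]
  exact key _

theorem charIdem_coeff (χ : H →* ℂˣ) (L : Subgroup G) (x : L) :
    (charIdem χ L).coeff ((x : G)⁻¹) = (Nat.card H : ℂ)⁻¹ * indChar χ L x := by
  classical
  simp [charIdem, Finsupp.single_apply]

theorem charIdem_coeff_of_notMem (χ : H →* ℂˣ) {L : Subgroup G} {g : G} (hg : g ∉ L) :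
    (charIdem χ L).coeff g = 0 := by
  classical
  rw [charIdem, coeff_smul_apply, coeff_sum, Finsupp.finsetSum_apply, Finset.sum_eq_zero,
    smul_zero]
  intro x _
  rw [coeff_single, Finsupp.single_apply, if_neg]
  rintro rfl
  exact hg (inv_mem x.2)

theorem indChar_eq_of_charIdem_eq {χ ψ : H →* ℂˣ} {L : Subgroup G}
    (h : charIdem ψ L = charIdem χ L) (x : L) : indChar ψ L x = indChar χ L x := by
  have h1 := congrArg (fun a : MonoidAlgebra ℂ G => a.coeff ((x : G)⁻¹)) h
  simp only [charIdem_coeff] at h1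
  exact mul_left_cancel₀ (inv_ne_zero (Nat.cast_ne_zero.2 Nat.card_pos.ne')) h1

/-- The values of `χ^L` generate the character field, so an embedding is determined by them. -/
theorem algHom_charField_ext {χ : H →* ℂˣ} {L : Subgroup G} {σ τ : charField χ L →ₐ[ℚ] ℂ}
    (h : ∀ x, σ (charValue χ L x) = τ (charValue χ L x)) : σ = τ := by
  ext ⟨a, ha⟩
  induction ha using IntermediateField.adjoin_induction with
  | mem a ha => obtain ⟨x, rfl⟩ := ha; exact h x
  | algebraMap q => exact (map_ratCast σ q).trans (map_ratCast τ q).symm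
  | add a b ha hb h1 h2 =>
    exact (map_add σ ⟨a, ha⟩ ⟨b, hb⟩).trans ((congrArg₂ _ h1 h2).trans
      (map_add τ ⟨a, ha⟩ ⟨b, hb⟩).symm)
  | mul a b ha hb h1 h2 =>
    exact (map_mul σ ⟨a, ha⟩ ⟨b, hb⟩).trans ((congrArg₂ _ h1 h2).trans
      (map_mul τ ⟨a, ha⟩ ⟨b, hb⟩).symm)
  | inv a ha h1 =>
    exact (map_inv₀ σ ⟨a, ha⟩).trans ((congrArg _ h1).trans (map_inv₀ τ ⟨a, ha⟩).symm)

/-- Among the Galois conjugates of `charIdem χ L`, only `charIdem χ L` itself does not kill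
`linIdem χ`. -/
theorem toComplex_eQ_mul_linIdem {χ : H →* ℂˣ} (hs : IsSeparating χ) {L : Subgroup G}
    (hL : H ≤ L) : toComplex (eQ χ L) * linIdem χ = linIdem χ := by
  classical
  -- the inclusion of the character field, over the `ℚ`-algebra structure of a division ring of
  -- characteristic zero, which the trace in `eQ` refers to
  let v : charField χ L →ₐ[ℚ] ℂ := (charField χ L).val.toRingHom.toRatAlgHom
  rw [toComplex_eQ, Finset.sum_mul, Finset.sum_eq_single v]
  · have hv : mapRingHom G v.toRingHom (charIdemField χ L) = charIdem χ L :=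
      map_val_charIdemField χ L
    rw [hv, charIdem_mul_linIdem hs hL]
  · intro σ _ hσ
    obtain ⟨ψ, hψ, hψσ⟩ := exists_linChar_indChar_eq hs L σ
    have e : mapRingHom G σ.toRingHom (charIdemField χ L) = charIdem ψ L := by
      rw [charIdemField, charIdem, map_sum, Finset.smul_sum]
      refine Finset.sum_congr rfl fun x _ => ?_
      rw [mapRingHom_single, smul_single, map_mul, map_inv₀, map_natCast, hψσ]
      rfl
    rw [e]
    refine charIdem_mul_linIdem_eq_zero hs hψ hL fun h => hσ ?_
    refine algHom_charField_ext fun x => ?_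
    rw [← hψσ, indChar_eq_of_charIdem_eq h x]
    rfl
  · simp

/-- An element of `ℚG` commuting with `L` acts on `charIdem χ L` by a scalar, so its product with
`e_ℚ(χ^L)` is supported on `L`. -/
theorem mul_eQ_mem {χ : H →* ℂˣ} (hs : IsSeparating χ) {L : Subgroup G} (hL : H ≤ L)
    {z : MonoidAlgebra ℚ G} (hz : ∀ l ∈ L, Commute (single l 1) z) :
    z * eQ χ L ∈ groupSubalgebra L := by
  obtain ⟨c, hc⟩ := exists_mul_linIdem hs (z := toComplex z)
    fun h hh => commute_toComplex (hz h (hL hh))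
  have hp := mul_charIdem χ hL (fun l hl => commute_toComplex (hz l hl)) hc
  rw [← map_val_mul_charIdemField] at hp
  refine mem_groupSubalgebra_of_coeff fun g hg => ?_
  have h1 := congrArg (fun a : MonoidAlgebra ℂ G => a.coeff g) hp
  simp only [coeff_mapRingHom, coeff_smul_apply, charIdem_coeff_of_notMem χ hg, smul_zero] at h1
  have h2 := (map_eq_zero (charField χ L).val.toRingHom).1 h1
  rw [mul_eQ_eq_map_trace, coeff_map]
  simp only [Finsupp.mapRange_apply]
  rw [h2, _root_.map_zero]

theorem eQ_mul_self {χ : H →* ℂˣ} (hs : IsSeparating χ) {L : Subgroup G} (hL : H ≤ L) :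
    eQ χ L * eQ χ L = eQ χ L :=
  mul_eQ_eq_self χ hL (fun l hl => single_mul_eQ χ L ⟨l, hl⟩) (toComplex_eQ_mul_linIdem hs hL)

theorem eQ_mul_eQ_of_le {χ : H →* ℂˣ} (hs : IsSeparating χ) {L M : Subgroup G} (hL : H ≤ L)
    (hLM : L ≤ M) : eQ χ M * eQ χ L = eQ χ L :=
  mul_eQ_eq_self χ hL (fun l hl => single_mul_eQ χ M ⟨l, hLM hl⟩)
    (toComplex_eQ_mul_linIdem hs (hL.trans hLM))

end Trace

/-! ### Conjugation in the rational group algebra -/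

theorem single_inv_mul_single (g : G) :
    (single g⁻¹ 1 * single g 1 : MonoidAlgebra ℚ G) = 1 := by
  simpa using single_mul_single_inv g⁻¹

theorem conj_eq_self_iff {a : MonoidAlgebra ℚ G} {g : G} :
    conj a g = a ↔ Commute (single g 1) a := by
  constructor
  · intro h
    rw [Commute, SemiconjBy, ← h, conj]
    conv_rhs => rw [← conj, h]
    rw [← mul_assoc, ← mul_assoc, single_mul_single_inv, one_mul]
  · intro h
    rw [conj, mul_assoc, ← h.eq, ← mul_assoc, single_inv_mul_single, one_mul]

theorem conj_conj (a : MonoidAlgebra ℚ G) (g h : G) : conj (conj a g) h = conj a (g * h) := by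
  have e1 : (single (g * h) 1 : MonoidAlgebra ℚ G) = single g 1 * single h 1 := by
    simp [single_mul_single]
  have e2 : (single (g * h)⁻¹ 1 : MonoidAlgebra ℚ G) = single h⁻¹ 1 * single g⁻¹ 1 := by
    simp [single_mul_single]
  simp only [conj, e1, e2, mul_assoc]

theorem single_mem_groupSubalgebra {L : Subgroup G} {g : G} (hg : g ∈ L) :
    single g 1 ∈ groupSubalgebra L :=
  ⟨single ⟨g, hg⟩ 1, by simp⟩

theorem groupSubalgebra_mono {L M : Subgroup G} (h : L ≤ M) :
    groupSubalgebra L ≤ groupSubalgebra M := by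
  rintro _ ⟨a, rfl⟩
  induction a using MonoidAlgebra.induction_linear with
  | zero => simp
  | add f g hf hg => rw [map_add]; exact add_mem hf hg
  | single l r => exact ⟨single ⟨l, h l.2⟩ r, by simp⟩

theorem conj_mem_groupSubalgebra {M : Subgroup G} {a : MonoidAlgebra ℚ G}
    (ha : a ∈ groupSubalgebra M) {g : G} (hg : g ∈ M) : conj a g ∈ groupSubalgebra M :=
  mul_mem (mul_mem (single_mem_groupSubalgebra (inv_mem hg)) ha) (single_mem_groupSubalgebra hg)

theorem commute_of_mem_groupSubalgebra {L : Subgroup G} {z a : MonoidAlgebra ℚ G}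
    (hz : ∀ l ∈ L, Commute (single l 1) z) (ha : a ∈ groupSubalgebra L) : Commute a z := by
  obtain ⟨b, rfl⟩ := ha
  induction b using MonoidAlgebra.induction_linear with
  | zero => simp
  | add f g hf hg => rw [map_add]; exact hf.add_left hg
  | single m r =>
    have h : (single (m : G) r : MonoidAlgebra ℚ G) = r • single (m : G) 1 := by simp
    simp only [AlgHom.toRingHom_eq_coe, RingHom.coe_coe, mapDomainAlgHom_apply,
      mapDomain_single, Subgroup.subtype_apply]
    rw [h]
    exact (hz m m.2).smul_left r

/-! ### Sums of conjugates -/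

section Average

variable [Fintype G]

open Classical in
/-- The sum of the conjugates of `w` by the elements of `M`, divided by `|C|`. When `C ≤ M`
centralizes `w`, this is the sum of the conjugates of `w` over the cosets of `C` in `M`. -/
noncomputable def conjSum (M C : Subgroup G) (w : MonoidAlgebra ℚ G) : MonoidAlgebra ℚ G :=
  (Nat.card C : ℚ)⁻¹ • ∑ g : M, conj w (g : G)

theorem commute_conjSum (M C : Subgroup G) (w : MonoidAlgebra ℚ G) {m : G} (hm : m ∈ M) :
    Commute (single m 1) (conjSum M C w) := by
  classical
  rw [← conj_eq_self_iff, conjSum]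
  have e : conj (∑ g : M, conj w (g : G)) m = ∑ g : M, conj w (g : G) := by
    conv_lhs => rw [conj, Finset.mul_sum, Finset.sum_mul]
    refine Fintype.sum_equiv (Equiv.mulRight (⟨m, hm⟩ : M)) _ _ fun g => ?_
    exact conj_conj w g m
  conv_rhs => rw [← e]
  rw [conj, conj, mul_smul_comm, smul_mul_assoc]

theorem conjSum_mem {M C : Subgroup G} {w : MonoidAlgebra ℚ G} (hw : w ∈ groupSubalgebra M) :
    conjSum M C w ∈ groupSubalgebra M :=
  Subalgebra.smul_mem _ (Subalgebra.sum_mem _ fun g _ => conj_mem_groupSubalgebra hw g.2) _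

theorem mul_conjSum (M C : Subgroup G) {z : MonoidAlgebra ℚ G}
    (hz : ∀ m ∈ M, Commute (single m 1) z) (w : MonoidAlgebra ℚ G) :
    z * conjSum M C w = conjSum M C (z * w) := by
  rw [conjSum, conjSum, mul_smul_comm, Finset.mul_sum]
  refine congrArg _ (Finset.sum_congr rfl fun g _ => ?_)
  rw [conj_mul, conj_eq_self_iff.2 (hz g g.2)]

/-- When the distinct conjugates of the idempotent `e` are orthogonal, multiplication by `e` picks
from the sum of the conjugates of `w ∈ (ℚG e)^C` the term `w`. -/
theorem conjSum_mul {M : Subgroup G} {e w : MonoidAlgebra ℚ G}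
    (horth : ∀ g ∈ M, ∀ h ∈ M, conj e g ≠ conj e h → conj e g * conj e h = 0)
    (hwe : w * e = w) (hw : ∀ c ∈ cen M e, conj w c = w) :
    conjSum M (cen M e) w * e = w := by
  classical
  have conj_one (a : MonoidAlgebra ℚ G) : conj a 1 = a := by simp [conj, ← one_def]
  have key (g : M) : conj w (g : G) * e = if (g : G) ∈ cen M e then w else 0 := by
    split_ifs with hg
    · rw [hw g hg, hwe]
    · have hne : conj e (g : G) ≠ conj e 1 := by
        rw [conj_one, Ne, conj_eq_self_iff]
        exact fun h => hg ⟨g.2, h⟩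
      have h0 := horth g g.2 1 (one_mem M) hne
      rw [conj_one] at h0
      rw [← hwe, conj_mul, mul_assoc, h0, mul_zero]
  rw [conjSum, smul_mul_assoc, Finset.sum_mul, Finset.sum_congr rfl fun g _ => key g,
    ← Finset.sum_filter, Finset.sum_const]
  have hcard : (Finset.univ.filter fun g : M => (g : G) ∈ cen M e).card =
      Nat.card (cen M e) := by
    rw [← Fintype.card_subtype, ← Nat.card_eq_fintype_card]
    exact Nat.card_congr (Subgroup.subgroupOfEquivOfLe (inf_le_left : cen M e ≤ M)).toEquiv
  rw [hcard, ← Nat.cast_smul_eq_nsmul ℚ, smul_smul,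
    inv_mul_cancel₀ (Nat.cast_ne_zero.2 Nat.card_pos.ne'), one_smul]

end Average

/-! ### The centers of the components -/

section Center

variable [Fintype G]

/-- `e_ℚ(χ^M)` is the sum of the distinct `M`-conjugates of `e_ℚ(χ^L)`. -/
theorem conjSum_eQ {χ : H →* ℂˣ} (hs : IsSeparating χ) {L M : Subgroup G} (hL : H ≤ L)
    (hLM : L ≤ M)
    (horth : ∀ g ∈ M, ∀ h ∈ M, conj (eQ χ L) g ≠ conj (eQ χ L) h →
      conj (eQ χ L) g * conj (eQ χ L) h = 0) :
    conjSum M (cen M (eQ χ L)) (eQ χ L) = eQ χ M := by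
  set E := conjSum M (cen M (eQ χ L)) (eQ χ L) with hE
  have hcomm : ∀ m ∈ M, Commute (single m 1) E := fun m hm => commute_conjSum _ _ _ hm
  have h1 : E * eQ χ L = eQ χ L :=
    conjSum_mul horth (eQ_mul_self hs hL) fun c hc => conj_eq_self_iff.2 hc.2
  have h2 : E * eQ χ M = eQ χ M := by
    refine mul_eQ_eq_self χ (hL.trans hLM) hcomm ?_
    conv_lhs => rw [← toComplex_eQ_mul_linIdem hs hL, ← mul_assoc, ← map_mul, h1]
    exact toComplex_eQ_mul_linIdem hs hL
  have h3 : eQ χ M * E = E := by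
    rw [hE, mul_conjSum M _ (fun m hm => single_mul_eQ χ M ⟨m, hm⟩), eQ_mul_eQ_of_le hs hL hLM]
  rw [← h3, (commute_of_mem_groupSubalgebra hcomm (eQ_mem χ M)).eq, h2]

theorem mem_component_iff {χ : H →* ℂˣ} (hs : IsSeparating χ) {L : Subgroup G} (hL : H ≤ L)
    {x : MonoidAlgebra ℚ G} :
    x ∈ component χ L ↔ x ∈ groupSubalgebra L ∧ x * eQ χ L = x := by
  constructor
  · rintro ⟨a, ha, rfl⟩
    exact ⟨mul_mem ha (eQ_mem χ L), by rw [mul_assoc, eQ_mul_self hs hL]⟩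
  · rintro ⟨hx, hxe⟩
    exact ⟨x, hx, hxe.symm⟩

theorem mem_componentCenter_iff {χ : H →* ℂˣ} (hs : IsSeparating χ) {L : Subgroup G}
    (hL : H ≤ L) {z : component χ L} :
    z ∈ componentCenter χ L ↔ ∀ l ∈ L, Commute (single l 1) (z : MonoidAlgebra ℚ G) := by
  obtain ⟨hzL, hze⟩ := (mem_component_iff hs hL).1 z.2
  rw [NonUnitalSubalgebra.mem_center_iff]
  constructor
  · intro h l hl
    have h1 := congrArg Subtype.val
      (h ⟨single l 1 * eQ χ L, _, single_mem_groupSubalgebra hl, rfl⟩)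
    simp only [NonUnitalSubalgebra.coe_mul] at h1
    rw [mul_assoc, ← mul_eQ χ L hzL, hze, mul_eQ χ L (single_mem_groupSubalgebra hl),
      ← mul_assoc, hze] at h1
    exact h1
  · intro h y
    exact Subtype.ext (commute_of_mem_groupSubalgebra h ((mem_component_iff hs hL).1 y.2).1)

/-- One step of the least center property. The inverse of `z ↦ z e` sends `w` to the sum of its
conjugates over the cosets of `C` in `M`. -/
theorem exists_componentCenter_equiv {χ : H →* ℂˣ} (hs : IsSeparating χ) {L M : Subgroup G}
    (hL : H ≤ L) (hLM : L ≤ M)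
    (horth : ∀ g ∈ M, ∀ h ∈ M, conj (eQ χ L) g ≠ conj (eQ χ L) h →
      conj (eQ χ L) g * conj (eQ χ L) h = 0) :
    ∃ Φ : componentCenter χ M ≃+* fixedCenter χ L (cen M (eQ χ L)),
      ∀ z : componentCenter χ M, ((Φ z : component χ L) : MonoidAlgebra ℚ G) =
        ((z : component χ M) : MonoidAlgebra ℚ G) * eQ χ L := by
  have hM := hL.trans hLM
  have hcomm (z : componentCenter χ M) : ∀ m ∈ M, Commute (single m 1)
      ((z : component χ M) : MonoidAlgebra ℚ G) := (mem_componentCenter_iff hs hM).1 z.2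
  have hze (z : componentCenter χ M) : Commute ((z : component χ M) : MonoidAlgebra ℚ G)
      (eQ χ L) :=
    (commute_of_mem_groupSubalgebra (hcomm z) (groupSubalgebra_mono hLM (eQ_mem χ L))).symm
  have hmem (z : componentCenter χ M) :
      ((z : component χ M) : MonoidAlgebra ℚ G) * eQ χ L ∈ component χ L :=
    (mem_component_iff hs hL).2
      ⟨mul_eQ_mem hs hL fun l hl => hcomm z l (hLM hl), by rw [mul_assoc, eQ_mul_self hs hL]⟩
  have hfix (z : componentCenter χ M) :
      (⟨_, hmem z⟩ : component χ L) ∈ fixedCenter χ L (cen M (eQ χ L)) := by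
    refine ⟨(mem_componentCenter_iff hs hL).2 fun l hl => ?_, fun c hc => ?_⟩
    · exact (hcomm z l (hLM hl)).mul_right (single_mul_eQ χ L ⟨l, hl⟩)
    · exact conj_eq_self_iff.2 ((hcomm z c hc.1).mul_right hc.2)
  let Ψ : componentCenter χ M →ₙ+* fixedCenter χ L (cen M (eQ χ L)) :=
    { toFun := fun z => ⟨⟨_, hmem z⟩, hfix z⟩
      map_zero' := by ext1; ext1; simp
      map_add' := fun z z' => by ext1; ext1; simp [add_mul]
      map_mul' := fun z z' => by
        refine Subtype.ext (Subtype.ext ?_)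
        change ((z : component χ M) : MonoidAlgebra ℚ G) * ((z' : component χ M) : _) * eQ χ L =
          ((z : component χ M) : MonoidAlgebra ℚ G) * eQ χ L *
            (((z' : component χ M) : MonoidAlgebra ℚ G) * eQ χ L)
        rw [mul_assoc, mul_assoc, ← mul_assoc (eQ χ L), ← (hze z').eq, mul_assoc _ (eQ χ L),
          eQ_mul_self hs hL] }
  have hΨ (z : componentCenter χ M) : ((Ψ z : component χ L) : MonoidAlgebra ℚ G) =
      ((z : component χ M) : MonoidAlgebra ℚ G) * eQ χ L := rfl
  have hinj : Function.Injective Ψ := by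
    -- `z` is recovered from `z e` as the sum of its conjugates, `e_ℚ(χ^M)` being that of `e`
    have hrec (z : componentCenter χ M) : ((z : component χ M) : MonoidAlgebra ℚ G) =
        conjSum M (cen M (eQ χ L)) (((z : component χ M) : MonoidAlgebra ℚ G) * eQ χ L) := by
      rw [← mul_conjSum M _ (hcomm z), conjSum_eQ hs hL hLM horth]
      exact ((mem_component_iff hs hM).1 (z : component χ M).2).2.symm
    intro z z' h
    refine Subtype.ext (Subtype.ext ?_)
    rw [hrec z, hrec z', ← hΨ, ← hΨ, h]
  have hsurj : Function.Surjective Ψ := by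
    rintro ⟨⟨w, hw⟩, hwc, hwfix⟩
    obtain ⟨hwL, hwe⟩ := (mem_component_iff hs hL).1 hw
    have hc : ∀ m ∈ M, Commute (single m 1) (conjSum M (cen M (eQ χ L)) w) :=
      fun m hm => commute_conjSum _ _ _ hm
    have hf : conjSum M (cen M (eQ χ L)) w * eQ χ M = conjSum M (cen M (eQ χ L)) w := by
      have e1 : eQ χ M * w = w := by
        rw [← mul_eQ χ M (groupSubalgebra_mono hLM hwL), ← hwe, mul_assoc,
          mul_eQ χ M (groupSubalgebra_mono hLM (eQ_mem χ L)), eQ_mul_eQ_of_le hs hL hLM]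
      rw [← (commute_of_mem_groupSubalgebra hc (eQ_mem χ M)).eq,
        mul_conjSum M _ (fun m hm => single_mul_eQ χ M ⟨m, hm⟩), e1]
    refine ⟨⟨⟨conjSum M (cen M (eQ χ L)) w, (mem_component_iff hs hM).2
      ⟨conjSum_mem (groupSubalgebra_mono hLM hwL), hf⟩⟩,
      (mem_componentCenter_iff hs hM).2 hc⟩, Subtype.ext (Subtype.ext ?_)⟩
    exact conjSum_mul horth hwe hwfix
  exact ⟨RingEquiv.ofBijective Ψ ⟨hinj, hsurj⟩, hΨ⟩

theorem IsStrongInductiveChain.le {χ : H →* ℂˣ} {n : ℕ} {N : Fin (n + 1) → Subgroup G}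
    (hN : IsStrongInductiveChain χ N) (i : Fin (n + 1)) : H ≤ N i := by
  induction i using Fin.induction with
  | zero => exact hN.bot.ge
  | succ i ih => exact ih.trans (hN.step i)

end Center

end ShodaTheory

theorem mainTheorem5 {G : Type*} [Group G] [Fintype G] (H K : Subgroup G)
    (hHK : ShodaTheory.IsGeneralizedStrongShodaPair H K)
    (χ : H →* ℂˣ) (hχ : χ.ker = K.subgroupOf H)
    (n : ℕ) (N : Fin (n + 1) → Subgroup G) (hN : ShodaTheory.IsStrongInductiveChain χ N) :
    ShodaTheory.HasLeastCenterProperty χ N :=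
  fun i => ShodaTheory.exists_componentCenter_equiv (hHK.1.isSeparating hχ) (hN.le _) (hN.step i)
    (hN.orthogonal i)
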